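/- Let $A$ and $B$ be two $n\times n$ matrix valued meromorphic functions on $\mathbb{C}$, both holomorphic at $0$, with $\det A(0)\neq 0$ and $\det B(0)\neq 0$. Then there exist nonzero complex numbers $z_1,z_2,\dots$ with $|z_k|\to\infty$ and orthogonal projection matrices $P_1,P_2,\dots$ of order $n\times n$ (possibly zero) such that the products $$\Pi_k(z)=E_k(z)E_{k-1}(z)\cdots E_1(z),\qquad E_k(z)=\exp\Big(\frac{z}{z_k}P_k+\frac12\frac{z^2}{z_k^2}P_k+\dots+\frac1k\frac{z^k}{z_k^k}P_k\Big)\Big(I_n-\frac{z}{z_k}P_k\Big),$$ with $\Pi_0=I_n$, converge in operator norm, uniformly on every bounded subset of $\mathbb{C}$, to an $n\times n$ matrix valued entire function $P$, and both $\tilde A(z)=P(z)A(z)$ and $\tilde B(z)=P(z)B(z)$ are entire (after removing singularities). Moreover, the $z_k$ and $P_k$ can be chosen so that they successively remove the poles of $A$ and $B$: for every $k\ge 1$, if $\Pi_{k-1}A$ or $\Pi_{k-1}B$ has a pole, then $z_k$ is a point nearest to the origin among all poles of these two functions, and the range of $P_k$ is the linear span of all pole vectors of $\Pi_{k-1}A$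 and of $\Pi_{k-1}B$ at $z_k$; if neither has a pole, then $P_k=0$. Here a pole of a matrix function is a pole of one of its entries, and a nonzero vector $v_1\in\mathbb{C}^n$ is a pole vector of $F$ at $z_0$ if there are $v_2,v_3,\dots\in\mathbb{C}^n$ such that the power series $\sum_{j\ge0}v_{j+1}(z-z_0)^j$ converges near $z_0$ and $F(z)^{-1}\sum_{j\ge0}v_{j+1}(z-z_0)^j$ is analytic at $z_0$ and has a zero there; at a point that is not a pole there are no pole vectors. -/

import Mathlib

open Filter Topology

noncomputable section

namespace MatrixFactorization

/-- A square matrix function on `ℂ` is meromorphic if all its entries are meromorphic on `ℂ`. -/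
def IsMeromorphic {n : ℕ} (F : ℂ → Matrix (Fin n) (Fin n) ℂ) : Prop :=
  ∀ i j, Meromorphic (fun z => F z i j)

/-- All the entries are analytic at `a`. -/
def IsHolomorphicAt {n : ℕ} (F : ℂ → Matrix (Fin n) (Fin n) ℂ) (a : ℂ) : Prop :=
  ∀ i j, AnalyticAt ℂ (fun z => F z i j) a

/-- All the entries are entire functions. -/
def IsEntire {n : ℕ} (F : ℂ → Matrix (Fin n) (Fin n) ℂ) : Prop :=
  ∀ i j, Differentiable ℂ (fun z => F z i j)

/-- `a` is a pole of `F` if it is a pole of one of the entries of `F`. -/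
def IsPole {n : ℕ} (F : ℂ → Matrix (Fin n) (Fin n) ℂ) (a : ℂ) : Prop :=
  ∃ i j, meromorphicOrderAt (fun z => F z i j) a < 0

/-- `u` is a pole vector of `F` at `a`: `u ≠ 0`, and there is a convergent power series
`v(z) = u + v₂ (z - a) + v₃ (z - a)² + ⋯` such that `F(z)⁻¹ v(z)` is analytic at `a`
(after removing the singularity at `a`) and has a zero there. -/
def IsPoleVector {n : ℕ} (F : ℂ → Matrix (Fin n) (Fin n) ℂ) (a : ℂ) (u : Fin n → ℂ) : Prop :=
  u ≠ 0 ∧ ∃ v g : ℂ → Fin n → ℂ,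
    AnalyticAt ℂ v a ∧ v a = u ∧ AnalyticAt ℂ g a ∧ g a = 0 ∧
      ∀ᶠ z in 𝓝[≠] a, (F z)⁻¹.mulVec (v z) = g z

/-- The linear span of all pole vectors of `A` and of `B` at `a`. -/
def poleSpan {n : ℕ} (A B : ℂ → Matrix (Fin n) (Fin n) ℂ) (a : ℂ) : Submodule ℂ (Fin n → ℂ) :=
  Submodule.span ℂ ({u | IsPoleVector A a u} ∪ {u | IsPoleVector B a u})

/-- The elementary factor
`exp ((z/a) Q + (1/2) (z/a)² Q + ⋯ + (1/m) (z/a)ᵐ Q) (I - (z/a) Q)`. -/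
def factor {n : ℕ} (m : ℕ) (a : ℂ) (Q : Matrix (Fin n) (Fin n) ℂ) (z : ℂ) :
    Matrix (Fin n) (Fin n) ℂ :=
  NormedSpace.exp (∑ j ∈ Finset.Icc 1 m, ((1 / (j : ℂ)) * (z / a) ^ j) • Q) * (1 - (z / a) • Q)

/-- The partial product `E_k(z) E_{k-1}(z) ⋯ E_1(z)`, new factors entering on the left. The
sequences are indexed from `0`, so `E_{k+1}(z) = factor (k + 1) (a k) (Q k) z`. -/
def partialProduct {n : ℕ} (a : ℕ → ℂ) (Q : ℕ → Matrix (Fin n) (Fin n) ℂ) :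
    ℕ → ℂ → Matrix (Fin n) (Fin n) ℂ
  | 0, _ => 1
  | k + 1, z => factor (k + 1) (a k) (Q k) z * partialProduct a Q k z

/-- `P` is the infinite product determined by the points `a k` and the matrices `Q k`: the `Q k`
are orthogonal projection matrices, the `a k` are nonzero with `|a k| → ∞`, and the partial
products converge to `P` in operator norm, uniformly on every bounded set. -/
structure IsInfiniteProduct {n : ℕ} (a : ℕ → ℂ) (Q : ℕ → Matrix (Fin n) (Fin n) ℂ)
    (P : ℂ → Matrix (Fin n) (Fin n) ℂ) : Prop where
  projection : ∀ k, IsStarProjection (Q k)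
  ne_zero : ∀ k, a k ≠ 0
  tendsto_norm : Tendsto (fun k => ‖a k‖) atTop atTop
  tendsto_product : ∀ S : Set ℂ, Bornology.IsBounded S →
    TendstoUniformlyOn
      (fun k z => Matrix.toEuclideanCLM (n := Fin n) (𝕜 := ℂ) (partialProduct a Q k z))
      (fun z => Matrix.toEuclideanCLM (n := Fin n) (𝕜 := ℂ) (P z)) atTop S

/-- One step of the removal of poles from the pair `A`, `B`: `a` is a pole of `A` or `B` nearest
to the origin (if there is any pole left), and the matrix `Q` has as its range the span of the
pole vectors of `A` and `B` at `a` (which is zero if there is no pole left). -/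
structure IsRemovalStep {n : ℕ} (A B : ℂ → Matrix (Fin n) (Fin n) ℂ) (a : ℂ)
    (Q : Matrix (Fin n) (Fin n) ℂ) : Prop where
  nearest : (∃ w, IsPole A w ∨ IsPole B w) →
    (IsPole A a ∨ IsPole B a) ∧ ∀ w, IsPole A w ∨ IsPole B w → ‖a‖ ≤ ‖w‖
  range_eq : LinearMap.range Q.mulVecLin = poleSpan A B a

end MatrixFactorization

end

noncomputable section

namespace MatrixFactorization

/-! Convergence: for idempotent `Q` the factor is `1 + (E_m(z/a) - 1) Q`, with `E_m` the scalar
Weierstrass primary factor (`factor_eq`). Since orthogonal projections have norm at most 1, the k-th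
factor is within a geometric bound of the identity once `|z| ≤ |a_k|/2`. The product thus converges
for any choice of projections with `|a_k| → ∞`.

Removal: at a pole `w` of order `p`, the columns of the leading coefficient `G(w)`, `G = (z - w)^p
F`, are zero or pole vectors, hence fixed by `Q`. The factor equals `1 - Q` at `w`, kills `G(w)`,
and lowers the pole order (`poleOrder_factor_mul_lt`); no pole order ever increases. A disc contains
finitely many poles, of finite total order, so it is visited finitely often and `|a_k| → ∞`
(`tendsto_norm_removal`). As `a_k` is a nearest pole, the k-th partial product leaves no pole in
`|z| < |a_k|`, and the remaining tail of the product is entire (`IsInfiniteProduct.not_isPole_mul`).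
-/

/-! ### Primary factors and exponentials of idempotents. -/

theorem exp_smul_of_isIdempotentElem {𝔸 : Type*} [Ring 𝔸] [Algebra ℂ 𝔸] [TopologicalSpace 𝔸]
    [IsTopologicalRing 𝔸] [ContinuousSMul ℂ 𝔸] [T2Space 𝔸] {Q : 𝔸} (hQ : IsIdempotentElem Q)
    (s : ℂ) : NormedSpace.exp (s • Q) = 1 + (Complex.exp s - 1) • Q := by
  rw [NormedSpace.exp_eq_tsum ℂ]
  have h1 : HasSum (fun n : ℕ => ((n.factorial : ℂ)⁻¹ • s ^ n) • Q) (Complex.exp s • Q) := by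
    rw [Complex.exp_eq_exp_ℂ]
    exact (NormedSpace.exp_series_hasSum_exp' (𝕂 := ℂ) s).smul_const Q
  -- The two series differ only in the term of index zero, which is `1` rather than `Q`.
  have h2 : HasSum (fun n : ℕ => if n = 0 then 1 - Q else 0) (1 - Q) := hasSum_ite_eq 0 (1 - Q)
  have h3 := h1.add h2
  refine Eq.trans (HasSum.tsum_eq ?_) (show Complex.exp s • Q + (1 - Q) = _ by
    rw [sub_smul, one_smul]; abel)
  convert h3 using 1
  funext n
  rcases n with _ | n
  · simp
  · simp [smul_pow, hQ.pow_succ_eq n, smul_smul]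

/-- The Weierstrass primary factor `exp (w + w²/2 + ⋯ + wᵐ/m) (1 - w)`. -/
def primaryFactor (m : ℕ) (w : ℂ) : ℂ :=
  Complex.exp (∑ j ∈ Finset.Icc 1 m, (1 / (j : ℂ)) * w ^ j) * (1 - w)

@[simp] theorem primaryFactor_zero (m : ℕ) : primaryFactor m 0 = 1 := by
  have : ∑ j ∈ Finset.Icc 1 m, (1 / (j : ℂ)) * (0 : ℂ) ^ j = 0 :=
    Finset.sum_eq_zero fun j hj => by
      rw [zero_pow (by have := (Finset.mem_Icc.1 hj).1; omega), mul_zero]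
  simp only [primaryFactor, this, Complex.exp_zero, sub_zero, mul_one]

@[simp] theorem primaryFactor_one (m : ℕ) : primaryFactor m 1 = 0 := by simp [primaryFactor]

theorem differentiable_primaryFactor (m : ℕ) : Differentiable ℂ (primaryFactor m) := by
  unfold primaryFactor
  fun_prop

/-- The exponent cancels the Taylor polynomial of `log (1 - w)`, so the primary factor is the
exponential of a remainder of size at most `(1/2)^m`. -/
theorem norm_primaryFactor_sub_one_le (m : ℕ) {w : ℂ} (hw : ‖w‖ ≤ 1 / 2) :
    ‖primaryFactor m w - 1‖ ≤ 2 * (1 / 2) ^ m := by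
  have hw1 : ‖-w‖ < 1 := by rw [norm_neg]; linarith
  have key := Complex.norm_log_sub_logTaylor_le m hw1
  have hT : Complex.logTaylor (m + 1) (-w) = -∑ j ∈ Finset.Icc 1 m, (1 / (j : ℂ)) * w ^ j := by
    -- The term of index zero is a division by zero, hence `0`.
    rw [Complex.logTaylor, Finset.sum_range_succ', ← Finset.sum_neg_distrib,
      Finset.range_eq_Ico, Finset.sum_Ico_add' (fun j : ℕ => (-1 : ℂ) ^ (j + 1) * (-w) ^ j / j)]
    simp only [Nat.cast_zero, div_zero, add_zero, zero_add]
    refine Finset.sum_congr (by ext; simp) fun j _ => ?_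
    rw [neg_pow w, pow_succ, show (-1 : ℂ) ^ j * -1 * ((-1) ^ j * w ^ j) =
      -(((-1) ^ j * (-1) ^ j) * w ^ j) by ring, ← mul_pow]
    simp; ring
  rw [hT, sub_neg_eq_add, norm_neg] at key
  have hne : 1 + -w ≠ 0 := by
    intro h
    have : w = 1 := by linear_combination -h
    rw [this] at hw; norm_num at hw
  set x := Complex.log (1 + -w) + ∑ j ∈ Finset.Icc 1 m, (1 / (j : ℂ)) * w ^ j with hx
  have hW : primaryFactor m w = Complex.exp x := by
    rw [hx, Complex.exp_add, Complex.exp_log hne, primaryFactor]; ring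
  have hxb : ‖x‖ ≤ (1 / 2) ^ m := by
    refine key.trans ?_
    have h1 : ‖w‖ ^ (m + 1) ≤ (1 / 2) ^ (m + 1) := by gcongr
    have h2 : (1 - ‖w‖)⁻¹ ≤ 2 := by
      rw [inv_le_comm₀ (by linarith) (by norm_num)]; linarith
    calc ‖w‖ ^ (m + 1) * (1 - ‖w‖)⁻¹ / (m + 1)
        ≤ ‖w‖ ^ (m + 1) * (1 - ‖w‖)⁻¹ :=
          div_le_self (mul_nonneg (by positivity) (inv_nonneg.2 (by linarith)))
            (by linarith [(Nat.cast_nonneg m : (0 : ℝ) ≤ m)])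
      _ ≤ (1 / 2) ^ (m + 1) * 2 := by
          apply mul_le_mul h1 h2 (inv_nonneg.2 (by linarith)) (by positivity)
      _ = (1 / 2) ^ m := by ring
  have hx1 : ‖x‖ ≤ 1 := hxb.trans (pow_le_one₀ (by norm_num) (by norm_num))
  rw [hW]
  exact (Complex.norm_exp_sub_one_le hx1).trans (by linarith)

section factor

variable {n : ℕ}

theorem factor_eq {Q : Matrix (Fin n) (Fin n) ℂ} (hQ : IsIdempotentElem Q) (m : ℕ) (a z : ℂ) :
    factor m a Q z = 1 + (primaryFactor m (z / a) - 1) • Q := by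
  rw [factor, ← Finset.sum_smul, exp_smul_of_isIdempotentElem hQ, primaryFactor]
  simp only [add_mul, mul_sub, one_mul, mul_one, smul_mul_assoc, mul_smul_comm, hQ.eq]
  module

theorem factor_apply_zero {Q : Matrix (Fin n) (Fin n) ℂ} (hQ : IsIdempotentElem Q) (m : ℕ)
    (a : ℂ) : factor m a Q 0 = 1 := by
  simp [factor_eq hQ]

theorem factor_apply_self {Q : Matrix (Fin n) (Fin n) ℂ} (hQ : IsIdempotentElem Q) (m : ℕ)
    {a : ℂ} (ha : a ≠ 0) : factor m a Q a = 1 - Q := by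
  simp [factor_eq hQ, ha, sub_eq_add_neg]

theorem isEntire_factor {Q : Matrix (Fin n) (Fin n) ℂ} (hQ : IsIdempotentElem Q) (m : ℕ)
    (a : ℂ) : IsEntire (factor m a Q) := by
  intro i j
  simp only [factor_eq hQ, Matrix.add_apply, Matrix.smul_apply, smul_eq_mul]
  exact (differentiable_const _).add ((((differentiable_primaryFactor m).comp
    (differentiable_id.div_const a)).sub_const 1).mul_const _)

end factor

/-! ### Convergence of products `∏ (1 + U k)` in a normed ring. -/

section convergence

variable {𝔸 X : Type*} [NormedRing 𝔸] [NormOneClass 𝔸]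

theorem norm_le_mul_exp_of_succ_eq {U T : ℕ → 𝔸} {ε : ℕ → ℝ} {C : ℝ} (hε : Summable ε)
    (hU : ∀ k, ‖U k‖ ≤ ε k) (h0 : ‖T 0‖ ≤ C) (hT : ∀ k, T (k + 1) = (1 + U k) * T k) (k : ℕ) :
    ‖T k‖ ≤ C * Real.exp (∑' j, ε j) := by
  have hε0 : ∀ k, 0 ≤ ε k := fun k => (norm_nonneg _).trans (hU k)
  have hC : 0 ≤ C := (norm_nonneg _).trans h0
  have h : ‖T k‖ ≤ C * Real.exp (∑ j ∈ Finset.range k, ε j) := by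
    induction k with
    | zero => simpa using h0
    | succ k ih =>
      rw [hT, Finset.sum_range_succ, Real.exp_add]
      calc ‖(1 + U k) * T k‖ ≤ ‖1 + U k‖ * ‖T k‖ := norm_mul_le _ _
        _ ≤ Real.exp (ε k) * (C * Real.exp (∑ j ∈ Finset.range k, ε j)) := by
            gcongr
            calc ‖1 + U k‖ ≤ ‖(1 : 𝔸)‖ + ‖U k‖ := norm_add_le _ _
              _ ≤ ε k + 1 := by rw [norm_one]; linarith [hU k]
              _ ≤ _ := Real.add_one_le_exp _
        _ = _ := by ring
  refine h.trans ?_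
  gcongr
  exact hε.sum_le_tsum _ fun i _ => hε0 i

/-- The increments are `U k * T k` with `T k` uniformly bounded, so the M-test applies to the
telescoping series. -/
theorem uniformCauchySeqOn_of_succ_eq {U T : ℕ → X → 𝔸} {S : Set X} {ε : ℕ → ℝ} {C : ℝ}
    [CompleteSpace 𝔸] (hε : Summable ε) (hU : ∀ k, ∀ x ∈ S, ‖U k x‖ ≤ ε k)
    (h0 : ∀ x ∈ S, ‖T 0 x‖ ≤ C) (hT : ∀ k, ∀ x ∈ S, T (k + 1) x = (1 + U k x) * T k x) :
    UniformCauchySeqOn T atTop S := by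
  have hb : ∀ k, ∀ x ∈ S, ‖T k x‖ ≤ C * Real.exp (∑' j, ε j) := fun k x hx =>
    norm_le_mul_exp_of_succ_eq (T := fun k => T k x) hε (fun k => hU k x hx) (h0 x hx)
      (fun k => hT k x hx) k
  have hsum : Summable fun k => ε k * (C * Real.exp (∑' j, ε j)) := hε.mul_right _
  have hd : ∀ k, ∀ x ∈ S, ‖T (k + 1) x - T k x‖ ≤ ε k * (C * Real.exp (∑' j, ε j)) := by
    intro k x hx
    rw [hT k x hx, add_mul, one_mul, add_sub_cancel_left]
    exact (norm_mul_le _ _).trans (mul_le_mul (hU k x hx) (hb k x hx) (norm_nonneg _)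
      ((norm_nonneg _).trans (hU k x hx)))
  have := (tendstoUniformlyOn_tsum_nat hsum hd).uniformCauchySeqOn
  rw [Metric.uniformCauchySeqOn_iff] at this ⊢
  intro δ hδ
  obtain ⟨N, hN⟩ := this δ hδ
  refine ⟨N, fun k hk l hl x hx => ?_⟩
  have h := hN k hk l hl x hx
  simpa [Finset.sum_range_sub (fun k => T k x), dist_sub_right] using h

end convergence

/-! ### Convergence of the matrix product. -/

section product

variable {n : ℕ}

/-- The product of the `k` elementary factors that follow the first `m`. -/
def tailProduct (a : ℕ → ℂ) (Q : ℕ → Matrix (Fin n) (Fin n) ℂ) (m : ℕ) :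
    ℕ → ℂ → Matrix (Fin n) (Fin n) ℂ
  | 0, _ => 1
  | k + 1, z => factor (m + k + 1) (a (m + k)) (Q (m + k)) z * tailProduct a Q m k z

theorem partialProduct_add (a : ℕ → ℂ) (Q : ℕ → Matrix (Fin n) (Fin n) ℂ) (m k : ℕ) (z : ℂ) :
    partialProduct a Q (m + k) z = tailProduct a Q m k z * partialProduct a Q m z := by
  induction k with
  | zero => simp [tailProduct]
  | succ k ih => rw [← add_assoc, partialProduct, ih, tailProduct, mul_assoc]

theorem partialProduct_eq_tailProduct (a : ℕ → ℂ) (Q : ℕ → Matrix (Fin n) (Fin n) ℂ) (k : ℕ)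
    (z : ℂ) : partialProduct a Q k z = tailProduct a Q 0 k z := by
  simpa [partialProduct] using partialProduct_add a Q 0 k z

/-- The operator norm representation of a matrix. -/
local notation "Φ" => Matrix.toEuclideanCLM (n := Fin n) (𝕜 := ℂ)

theorem IsEntire.mul {F G : ℂ → Matrix (Fin n) (Fin n) ℂ} (hF : IsEntire F) (hG : IsEntire G) :
    IsEntire (fun z => F z * G z) := by
  intro i j
  simp only [Matrix.mul_apply]
  exact Differentiable.fun_sum fun l _ => (hF i l).mul (hG l j)

theorem isEntire_tailProduct (a : ℕ → ℂ) {Q : ℕ → Matrix (Fin n) (Fin n) ℂ}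
    (hQ : ∀ k, IsStarProjection (Q k)) (m k : ℕ) : IsEntire (tailProduct a Q m k) := by
  induction k with
  | zero => exact fun i j => differentiable_const _
  | succ k ih => exact (isEntire_factor (hQ _).isIdempotentElem _ _).mul ih

/-- Reading an entry off a continuous linear operator. -/
def entryCLM (i j : Fin n) :
    (EuclideanSpace ℂ (Fin n) →L[ℂ] EuclideanSpace ℂ (Fin n)) →L[ℂ] ℂ :=
  LinearMap.toContinuousLinearMap
    ((Matrix.entryLinearMap ℂ ℂ i j).comp
      (Matrix.toEuclideanCLM (n := Fin n) (𝕜 := ℂ)).symm.toAlgEquiv.toLinearMap)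

@[simp] theorem entryCLM_apply (i j : Fin n) (M : Matrix (Fin n) (Fin n) ℂ) :
    entryCLM i j (Φ M) = M i j := by
  simp [entryCLM]

theorem isEntire_iff_differentiable {F : ℂ → Matrix (Fin n) (Fin n) ℂ} :
    IsEntire F ↔ Differentiable ℂ fun z => Φ (F z) := by
  constructor
  · intro h
    have h1 : Differentiable ℂ fun z => (fun i j => F z i j : Fin n → Fin n → ℂ) :=
      differentiable_pi.2 fun i => differentiable_pi.2 fun j => h i j
    exact (LinearMap.toContinuousLinearMap ((Φ).toAlgEquiv.toLinearMap ∘ₗ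
      (Matrix.ofLinearEquiv ℂ).toLinearMap)).differentiable.comp h1
  · intro h i j
    simpa [Function.comp_def] using (entryCLM i j).differentiable.comp h

theorem norm_toEuclideanCLM_le_one {Q : Matrix (Fin n) (Fin n) ℂ} (hQ : IsStarProjection Q) :
    ‖Φ Q‖ ≤ 1 :=
  (hQ.map Φ).norm_le

theorem uniformCauchySeqOn_tailProduct {a : ℕ → ℂ} {Q : ℕ → Matrix (Fin n) (Fin n) ℂ}
    (hQ : ∀ k, IsStarProjection (Q k)) (ha : Tendsto (fun k => ‖a k‖) atTop atTop) (m : ℕ)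
    {S : Set ℂ} (hS : Bornology.IsBounded S) :
    UniformCauchySeqOn (fun k z => Φ (tailProduct a Q m k z)) atTop S := by
  -- For `n = 0` the identity has norm `0`, so `NormOneClass` is not available.
  rcases isEmpty_or_nonempty (Fin n) with hn | hn
  · rw [Metric.uniformCauchySeqOn_iff]
    exact fun ε hε => ⟨0, fun k _ l _ x _ => by
      rw [Subsingleton.elim (tailProduct a Q m k x) (tailProduct a Q m l x), dist_self]
      exact hε⟩
  obtain ⟨R, hR0, hR⟩ := hS.exists_pos_norm_le
  -- From index `K` on, `|z / a_k| ≤ 1/2` on `S`; the earlier factors form the initial value,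
  -- bounded by `C` by compactness.
  obtain ⟨K, hK⟩ := eventually_atTop.1 (ha.eventually_ge_atTop (2 * R))
  obtain ⟨C, hC⟩ := (isCompact_closedBall (0 : ℂ) R).exists_bound_of_continuousOn
    (isEntire_iff_differentiable.1 (isEntire_tailProduct a hQ m K)).continuous.continuousOn
  have key := uniformCauchySeqOn_of_succ_eq
    (𝔸 := EuclideanSpace ℂ (Fin n) →L[ℂ] EuclideanSpace ℂ (Fin n))
    (T := fun k z => Φ (tailProduct a Q m (K + k) z))
    (U := fun k z => (primaryFactor (m + (K + k) + 1) (z / a (m + (K + k))) - 1) •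
      Φ (Q (m + (K + k)))) (S := S) (ε := fun k => 2 * (1 / 2) ^ k) (C := C)
    (summable_geometric_two.mul_left 2) ?_ ?_ ?_
  · rw [Metric.uniformCauchySeqOn_iff] at key ⊢
    intro ε hε
    obtain ⟨N, hN⟩ := key ε hε
    refine ⟨K + N, fun k hk l hl x hx => ?_⟩
    have := hN (k - K) (by omega) (l - K) (by omega) x hx
    rwa [Nat.add_sub_cancel' (by omega), Nat.add_sub_cancel' (by omega)] at this
  · intro k z hz
    have haz := hK (m + (K + k)) (by omega)
    have hz2 : ‖z / a (m + (K + k))‖ ≤ 1 / 2 := by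
      rw [norm_div, div_le_iff₀ (by linarith)]
      linarith [hR z hz]
    calc _ ≤ ‖primaryFactor (m + (K + k) + 1) (z / a (m + (K + k))) - 1‖ *
          ‖Φ (Q (m + (K + k)))‖ := norm_smul_le _ _
      _ ≤ (2 * (1 / 2) ^ (m + (K + k) + 1)) * 1 := by
          gcongr
          · exact norm_primaryFactor_sub_one_le _ hz2
          · exact norm_toEuclideanCLM_le_one (hQ _)
      _ ≤ _ := by
          rw [mul_one]
          gcongr 2 * ?_
          exact pow_le_pow_of_le_one (by norm_num) (by norm_num) (by omega)
  · exact fun z hz => hC z (by simpa using hR z hz)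
  · intro k z _
    simp [← add_assoc, tailProduct, factor_eq (hQ _).isIdempotentElem]

theorem exists_isEntire_tendstoUniformlyOn_tailProduct {a : ℕ → ℂ}
    {Q : ℕ → Matrix (Fin n) (Fin n) ℂ} (hQ : ∀ k, IsStarProjection (Q k))
    (ha : Tendsto (fun k => ‖a k‖) atTop atTop) (m : ℕ) :
    ∃ P : ℂ → Matrix (Fin n) (Fin n) ℂ, IsEntire P ∧ ∀ S : Set ℂ, Bornology.IsBounded S →
      TendstoUniformlyOn (fun k z => Φ (tailProduct a Q m k z)) (fun z => Φ (P z)) atTop S := by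
  have hc : ∀ z, ∃ M : Matrix (Fin n) (Fin n) ℂ,
      Tendsto (fun k => Φ (tailProduct a Q m k z)) atTop (𝓝 (Φ M)) := by
    intro z
    obtain ⟨x, hx⟩ := cauchySeq_tendsto_of_complete
      ((uniformCauchySeqOn_tailProduct hQ ha m (S := {z}) Bornology.isBounded_singleton).cauchySeq
        (Set.mem_singleton z))
    exact ⟨(Φ).symm x, by simpa using hx⟩
  choose P hP using hc
  have hu : ∀ S : Set ℂ, Bornology.IsBounded S →
      TendstoUniformlyOn (fun k z => Φ (tailProduct a Q m k z)) (fun z => Φ (P z)) atTop S :=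
    fun S hS => (uniformCauchySeqOn_tailProduct hQ ha m hS).tendstoUniformlyOn_of_tendsto
      fun z _ => hP z
  refine ⟨P, isEntire_iff_differentiable.2 (differentiableOn_univ.1 ?_), hu⟩
  refine TendstoLocallyUniformlyOn.differentiableOn (φ := atTop)
    (F := fun k z => Φ (tailProduct a Q m k z)) ?_ (Eventually.of_forall fun k =>
      (isEntire_iff_differentiable.1 (isEntire_tailProduct a hQ m k)).differentiableOn) isOpen_univ
  rw [tendstoLocallyUniformlyOn_univ]
  refine tendstoLocallyUniformly_of_forall_exists_nhds fun z =>
    ⟨Metric.ball z 1, Metric.ball_mem_nhds z one_pos, hu _ Metric.isBounded_ball⟩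

/-- The infinite product splits off its first `m` factors. -/
theorem IsInfiniteProduct.exists_eq_mul_partialProduct {a : ℕ → ℂ}
    {Q : ℕ → Matrix (Fin n) (Fin n) ℂ} {P : ℂ → Matrix (Fin n) (Fin n) ℂ}
    (h : IsInfiniteProduct a Q P) (m : ℕ) :
    ∃ R, IsEntire R ∧ ∀ z, P z = R z * partialProduct a Q m z := by
  obtain ⟨R, hR, hRu⟩ := exists_isEntire_tendstoUniformlyOn_tailProduct h.projection
    h.tendsto_norm m
  refine ⟨R, hR, fun z => (Φ).injective ?_⟩
  have h1 := (h.tendsto_product {z} Bornology.isBounded_singleton).tendsto_at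
    (Set.mem_singleton z)
  have h2 := (hRu {z} Bornology.isBounded_singleton).tendsto_at (Set.mem_singleton z)
  rw [map_mul]
  refine tendsto_nhds_unique (h1.comp (tendsto_add_atTop_nat m)) ?_
  convert h2.mul_const (Φ (partialProduct a Q m z)) using 2 with k
  · simp [add_comm k m, partialProduct_add]
  · rfl

end product

variable {n : ℕ}

/-! ### Meromorphic matrix functions and removable singularities. -/

section entire

variable {F G : ℂ → Matrix (Fin n) (Fin n) ℂ} {w : ℂ}

theorem IsEntire.isHolomorphicAt (hF : IsEntire F) (w : ℂ) : IsHolomorphicAt F w :=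
  fun i j => (hF i j).analyticAt w

theorem IsHolomorphicAt.mul (hF : IsHolomorphicAt F w) (hG : IsHolomorphicAt G w) :
    IsHolomorphicAt (fun z => F z * G z) w := by
  intro i j
  simp only [Matrix.mul_apply]
  exact Finset.analyticAt_fun_sum _ fun l _ => (hF i l).mul (hG l j)

theorem IsEntire.isMeromorphic (hF : IsEntire F) : IsMeromorphic F :=
  fun i j z => ((hF i j).analyticAt z).meromorphicAt

theorem IsMeromorphic.mul (hF : IsMeromorphic F) (hG : IsMeromorphic G) :
    IsMeromorphic (fun z => F z * G z) := by
  intro i j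
  simp only [Matrix.mul_apply]
  exact Meromorphic.fun_sum fun l _ => (hF i l).fun_mul (hG l j)

theorem IsMeromorphic.det (hF : IsMeromorphic F) : Meromorphic fun z => (F z).det := by
  simp only [Matrix.det_apply']
  exact Meromorphic.fun_sum fun σ _ =>
    (Meromorphic.const _).fun_mul (Meromorphic.fun_prod fun i _ => hF _ _)

theorem IsHolomorphicAt.continuousAt_det (hF : IsHolomorphicAt F w) :
    ContinuousAt (fun z => (F z).det) w := by
  simp only [Matrix.det_apply']
  exact tendsto_finsetSum _ fun σ _ => tendsto_const_nhds.mul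
    (tendsto_finsetProd _ fun i _ => (hF _ _).continuousAt)

/-- By the identity principle on `ℂ`, the determinant has finite order everywhere as soon as it does
at `b`. -/
theorem IsMeromorphic.eventually_det_ne_zero (hF : IsMeromorphic F) {b : ℂ}
    (hb : IsHolomorphicAt F b) (hdet : (F b).det ≠ 0) (w : ℂ) :
    ∀ᶠ z in 𝓝[≠] w, (F z).det ≠ 0 := by
  have hm := hF.det
  refine (meromorphicOrderAt_ne_top_iff_eventually_ne_zero (hm w)).1
    (hm.exists_meromorphicOrderAt_ne_top_iff_forall.1 ⟨b, ?_⟩ w)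
  exact (meromorphicOrderAt_ne_top_iff_eventually_ne_zero (hm b)).2
    (nhdsWithin_le_nhds (hb.continuousAt_det.eventually_ne hdet))

end entire

section glue

theorem exists_differentiable_of_removable {f : ℂ → ℂ}
    (h : ∀ w, ∃ g : ℂ → ℂ, AnalyticAt ℂ g w ∧ f =ᶠ[𝓝[≠] w] g) :
    ∃ f' : ℂ → ℂ, Differentiable ℂ f' ∧ ∀ z, AnalyticAt ℂ f z → f' z = f z := by
  choose g hg hfg using h
  have hval : ∀ z, AnalyticAt ℂ f z → g z z = f z := fun z hz =>
    ((hz.continuousAt.eventuallyEq_nhds_iff_eventuallyEq_nhdsNE (hg z).continuousAt).1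
      (hfg z)).eq_of_nhds.symm
  -- The local extensions are glued along the diagonal: near `w`, `f` is analytic off `w`, so `g z z
  -- = f z = g w z`.
  refine ⟨fun z => g z z, fun w => ?_, hval⟩
  have hm : MeromorphicAt f w := (hg w).meromorphicAt.congr (hfg w).symm
  have h1 : ∀ᶠ z in 𝓝[≠] w, g z z = g w z := by
    filter_upwards [hm.eventually_analyticAt, hfg w] with z hz hz'
    rw [hval z hz, hz']
  have h2 : (fun z => g z z) =ᶠ[𝓝 w] g w := by
    filter_upwards [eventually_nhdsWithin_iff.1 h1] with z hz
    by_cases hzw : z = w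
    · rw [hzw]
    · exact hz hzw
  exact h2.differentiableAt_iff.2 (hg w).differentiableAt

theorem exists_isEntire_of_not_isPole {F : ℂ → Matrix (Fin n) (Fin n) ℂ} (hF : IsMeromorphic F)
    (h : ∀ w, ¬ IsPole F w) :
    ∃ F' : ℂ → Matrix (Fin n) (Fin n) ℂ, IsEntire F' ∧
      ∀ z, IsHolomorphicAt F z → F' z = F z := by
  have h1 : ∀ i j, ∃ f' : ℂ → ℂ, Differentiable ℂ f' ∧
      ∀ z, AnalyticAt ℂ (fun z => F z i j) z → f' z = F z i j := fun i j =>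
    exists_differentiable_of_removable fun w =>
      (hF i j w).meromorphicOrderAt_nonneg_iff.1 (not_lt.1 fun hlt => h w ⟨i, j, hlt⟩)
  choose f' hf' hval using h1
  exact ⟨fun z => Matrix.of fun i j => f' i j z, hf', fun z hz => by
    ext i j; exact hval i j z (hz i j)⟩

end glue

/-! ### Pole orders and their decrease under a factor. -/

section poleOrder

/-- The least `p` such that `(z - w)ᵖ F(z)` is analytic at `w`. -/
def poleOrder (F : ℂ → Matrix (Fin n) (Fin n) ℂ) (w : ℂ) : ℕ :=
  sInf {p : ℕ | ∃ G : ℂ → Matrix (Fin n) (Fin n) ℂ, IsHolomorphicAt G w ∧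
    ∀ᶠ z in 𝓝[≠] w, (z - w) ^ p • F z = G z}

variable {F G H : ℂ → Matrix (Fin n) (Fin n) ℂ} {w : ℂ}

theorem poleOrder_le {p : ℕ} (hG : IsHolomorphicAt G w)
    (h : ∀ᶠ z in 𝓝[≠] w, (z - w) ^ p • F z = G z) : poleOrder F w ≤ p :=
  Nat.sInf_le ⟨G, hG, h⟩

theorem IsMeromorphic.exists_poleOrder (hF : IsMeromorphic F) (w : ℂ) :
    ∃ G : ℂ → Matrix (Fin n) (Fin n) ℂ, IsHolomorphicAt G w ∧
      ∀ᶠ z in 𝓝[≠] w, (z - w) ^ poleOrder F w • F z = G z := by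
  refine Nat.sInf_mem (s := {p : ℕ | ∃ G : ℂ → Matrix (Fin n) (Fin n) ℂ, IsHolomorphicAt G w ∧
    ∀ᶠ z in 𝓝[≠] w, (z - w) ^ p • F z = G z}) ?_
  choose p hp using fun i j => hF i j w
  -- Any common upper bound of the exponents `p i j` serves; the sum is one.
  refine ⟨∑ i, ∑ j, p i j, fun z => (z - w) ^ (∑ i, ∑ j, p i j) • F z, fun i j => ?_,
    Eventually.of_forall fun _ => rfl⟩
  have hle : p i j ≤ ∑ i, ∑ j, p i j :=
    (Finset.single_le_sum (f := p i) (fun _ _ => Nat.zero_le _) (Finset.mem_univ j)).trans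
      (Finset.single_le_sum (f := fun i => ∑ j, p i j) (fun _ _ => Nat.zero_le _)
        (Finset.mem_univ i))
  have : (fun z => ((z - w) ^ (∑ i, ∑ j, p i j) • F z) i j) =
      fun z => (z - w) ^ ((∑ i, ∑ j, p i j) - p i j) * ((z - w) ^ p i j • F z i j) := by
    funext z
    rw [smul_eq_mul, ← mul_assoc, ← pow_add, Nat.sub_add_cancel hle, Matrix.smul_apply,
      smul_eq_mul]
  rw [this]
  exact AnalyticAt.mul (by fun_prop) (hp i j)

theorem IsMeromorphic.isPole_iff (hF : IsMeromorphic F) : IsPole F w ↔ poleOrder F w ≠ 0 := by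
  rw [← not_iff_not, not_not]
  constructor
  · intro h
    have h1 := fun i j => (hF i j w).meromorphicOrderAt_nonneg_iff.1
      (not_lt.1 fun hlt => h ⟨i, j, hlt⟩)
    choose g hg hfg using h1
    refine Nat.le_zero.1 (poleOrder_le (G := fun z => Matrix.of fun i j => g i j z) hg ?_)
    filter_upwards [eventually_all.2 fun i => eventually_all.2 fun j => hfg i j] with z hz
    ext i j
    simpa using hz i j
  · rintro h ⟨i, j, hlt⟩
    obtain ⟨G, hG, hFG⟩ := hF.exists_poleOrder w
    refine not_le.2 hlt ((hF i j w).meromorphicOrderAt_nonneg_iff.2 ⟨_, hG i j, ?_⟩)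
    filter_upwards [hFG] with z hz
    rw [← hz, h, pow_zero, one_smul]

theorem IsHolomorphicAt.not_isPole (hF : IsHolomorphicAt F w) : ¬ IsPole F w := by
  rintro ⟨i, j, hlt⟩
  exact not_le.2 hlt (hF i j).meromorphicOrderAt_nonneg

theorem IsMeromorphic.poleOrder_mul_le (hF : IsMeromorphic F) (hH : IsHolomorphicAt H w) :
    poleOrder (fun z => H z * F z) w ≤ poleOrder F w := by
  obtain ⟨G, hG, hFG⟩ := hF.exists_poleOrder w
  refine poleOrder_le (hH.mul hG) ?_
  filter_upwards [hFG] with z hz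
  rw [← hz, mul_smul_comm]

/-- The columns of the leading coefficient at a pole are pole vectors. -/
theorem isPoleVector_col {p : ℕ} (hp : p ≠ 0) (hG : IsHolomorphicAt G w)
    (hFG : ∀ᶠ z in 𝓝[≠] w, (z - w) ^ p • F z = G z) (hdet : ∀ᶠ z in 𝓝[≠] w, (F z).det ≠ 0)
    {j : Fin n} (hj : (G w).col j ≠ 0) : IsPoleVector F w ((G w).col j) := by
  -- Since `G = (z - w)^p F`, applying `F⁻¹` to the j-th column of `G` gives `(z - w)^p e_j`.
  refine ⟨hj, fun z => (G z).col j, fun z => (z - w) ^ p • Pi.single j 1,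
    analyticAt_pi_iff.2 fun i => hG i j, rfl,
    (show AnalyticAt ℂ (fun z => (z - w) ^ p) w by fun_prop).smul analyticAt_const,
    by simp [hp], ?_⟩
  filter_upwards [hFG, hdet] with z hz hd
  rw [← Matrix.mulVec_single_one (G z), ← hz, Matrix.smul_mulVec, Matrix.mulVec_smul,
    Matrix.mulVec_mulVec, Matrix.nonsing_inv_mul _ (isUnit_iff_ne_zero.2 hd), Matrix.one_mulVec]

theorem IsHolomorphicAt.exists_sub_smul (hF : IsHolomorphicAt F w) (h0 : F w = 0) :
    ∃ G, IsHolomorphicAt G w ∧ ∀ᶠ z in 𝓝 w, F z = (z - w) • G z := by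
  have h1 : ∀ i j, ∃ g : ℂ → ℂ, AnalyticAt ℂ g w ∧
      ∀ᶠ z in 𝓝 w, F z i j = (z - w) ^ 1 • g z := fun i j => by
    refine (natCast_le_analyticOrderAt (hF i j)).1 ?_
    rw [Nat.cast_one, Order.one_le_iff_ne_zero, (hF i j).analyticOrderAt_ne_zero]
    simp [h0]
  choose g hg hfg using h1
  refine ⟨fun z => Matrix.of fun i j => g i j z, hg, ?_⟩
  filter_upwards [eventually_all.2 fun i => eventually_all.2 fun j => hfg i j] with z hz
  ext i j
  simpa using hz i j

theorem IsMeromorphic.poleOrder_factor_mul_lt (hF : IsMeromorphic F)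
    (hdet : ∀ᶠ z in 𝓝[≠] w, (F z).det ≠ 0) (hw : w ≠ 0) (hpole : IsPole F w)
    {Q : Matrix (Fin n) (Fin n) ℂ} (hQ : IsIdempotentElem Q)
    (hV : ∀ u, IsPoleVector F w u → u ∈ LinearMap.range Q.mulVecLin) (m : ℕ) :
    poleOrder (fun z => factor m w Q z * F z) w < poleOrder F w := by
  have hp := hF.isPole_iff.1 hpole
  obtain ⟨G, hG, hFG⟩ := hF.exists_poleOrder w
  have hcol : ∀ j, Q.mulVec ((G w).col j) = (G w).col j := by
    intro j
    by_cases hj : (G w).col j = 0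
    · rw [hj, Matrix.mulVec_zero]
    · obtain ⟨x, hx⟩ := hV _ (isPoleVector_col hp hG hFG hdet hj)
      rw [← hx, Matrix.mulVecLin_apply, Matrix.mulVec_mulVec, hQ.eq]
  have hzero : factor m w Q w * G w = 0 := by
    have hQG : Q * G w = G w := by
      ext i j
      exact congrFun (hcol j) i
    rw [factor_apply_self hQ m hw, sub_mul, one_mul, hQG, sub_self]
  obtain ⟨K, hK, hGK⟩ :=
    (((isEntire_factor hQ m w).isHolomorphicAt w).mul hG).exists_sub_smul hzero
  refine (poleOrder_le (p := poleOrder F w - 1) hK ?_).trans_lt (by omega)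
  filter_upwards [hFG, nhdsWithin_le_nhds hGK, self_mem_nhdsWithin] with z hz hz' hzw
  have hne : z - w ≠ 0 := sub_ne_zero.2 hzw
  refine smul_right_injective _ hne ?_
  simp only
  rw [← hz', ← hz, smul_smul, ← pow_succ', Nat.sub_add_cancel (Nat.one_le_iff_ne_zero.2 hp),
    mul_smul_comm]

/-- Each point has a neighbourhood with no other pole; compactness does the rest. -/
theorem IsMeromorphic.finite_isPole_inter (hF : IsMeromorphic F) {K : Set ℂ} (hK : IsCompact K) :
    (K ∩ {w | IsPole F w}).Finite := by
  refine hK.induction_on (p := fun s => (s ∩ {w | IsPole F w}).Finite) (by simp)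
    (fun s t hst ht => ht.subset (Set.inter_subset_inter_left _ hst))
    (fun s t hs ht => by rw [Set.union_inter_distrib_right]; exact hs.union ht) fun x _ => ?_
  have h : ∀ᶠ z in 𝓝[≠] x, ¬ IsPole F z := by
    filter_upwards [eventually_all.2 fun i => eventually_all.2 fun j =>
      (hF i j x).eventually_analyticAt] with z hz
    exact IsHolomorphicAt.not_isPole hz
  refine ⟨_, mem_nhdsWithin_of_mem_nhds (eventually_nhdsWithin_iff.1 h), ?_⟩
  refine (Set.finite_singleton x).subset fun z hz => ?_
  by_contra hzx
  exact hz.1 hzx hz.2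

end poleOrder

/-! ### Construction of the points and projections. -/

section step

theorem exists_isStarProjection_range_eq (V : Submodule ℂ (Fin n → ℂ)) :
    ∃ Q : Matrix (Fin n) (Fin n) ℂ, IsStarProjection Q ∧ LinearMap.range Q.mulVecLin = V := by
  -- Orthogonal projection needs the inner product, so `V` is moved to Euclidean space.
  let V' : Submodule ℂ (EuclideanSpace ℂ (Fin n)) :=
    V.comap (WithLp.linearEquiv 2 ℂ (Fin n → ℂ)).toLinearMap
  have hmem : ∀ x, x ∈ V' ↔ WithLp.ofLp x ∈ V := fun x => Iff.rfl
  set Q := (Matrix.toEuclideanCLM (n := Fin n) (𝕜 := ℂ)).symm V'.starProjection with hQ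
  have hΦ : Matrix.toEuclideanCLM (n := Fin n) (𝕜 := ℂ) Q = V'.starProjection := by simp [hQ]
  have hproj : IsStarProjection V'.starProjection := isStarProjection_starProjection
  have hmul : Q * Q = Q := by
    apply (Matrix.toEuclideanCLM (n := Fin n) (𝕜 := ℂ)).injective
    refine (map_mul (Matrix.toEuclideanCLM (n := Fin n) (𝕜 := ℂ)) Q Q).trans ?_
    rw [hΦ]
    exact hproj.isIdempotentElem.eq.trans hΦ.symm
  have hstar : star Q = Q := by
    apply (Matrix.toEuclideanCLM (n := Fin n) (𝕜 := ℂ)).injective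
    refine (map_star (Matrix.toEuclideanCLM (n := Fin n) (𝕜 := ℂ)) Q).trans ?_
    rw [hΦ]
    exact hproj.isSelfAdjoint.star_eq.trans hΦ.symm
  refine ⟨Q, ⟨hmul, hstar⟩, ?_⟩
  have hval : ∀ y : Fin n → ℂ, Q.mulVec y =
      WithLp.ofLp (V'.starProjection (WithLp.toLp 2 y)) := fun y => by
    rw [← hΦ, Matrix.ofLp_toEuclideanCLM]
  ext x
  constructor
  · rintro ⟨y, rfl⟩
    rw [Matrix.mulVecLin_apply, hval, ← hmem]
    exact V'.starProjection_apply_mem _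
  · intro hx
    refine ⟨x, ?_⟩
    rw [Matrix.mulVecLin_apply, hval,
      Submodule.starProjection_eq_self_iff.2 ((hmem (WithLp.toLp 2 x)).2 hx)]

variable {A B : ℂ → Matrix (Fin n) (Fin n) ℂ}

theorem exists_nearest_isPole (hA : IsMeromorphic A) (hB : IsMeromorphic B)
    (h : ∃ w, IsPole A w ∨ IsPole B w) :
    ∃ a, (IsPole A a ∨ IsPole B a) ∧ ∀ w, IsPole A w ∨ IsPole B w → ‖a‖ ≤ ‖w‖ := by
  obtain ⟨b, hb⟩ := h
  have hK := isCompact_closedBall (0 : ℂ) ‖b‖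
  have hfin := (hA.finite_isPole_inter hK).union (hB.finite_isPole_inter hK)
  rw [← Set.inter_union_distrib_left] at hfin
  obtain ⟨a, ha, hmin⟩ := Set.exists_min_image _ (fun z : ℂ => ‖z‖) hfin ⟨b, by simp, hb⟩
  refine ⟨a, ha.2, fun w hw => ?_⟩
  rcases le_total ‖w‖ ‖b‖ with h | h
  · exact hmin w ⟨by simpa using h, hw⟩
  · exact (show ‖a‖ ≤ ‖b‖ by simpa using ha.1).trans h

theorem exists_isRemovalStep (hA : IsMeromorphic A) (hB : IsMeromorphic B) (b : ℂ) :
    ∃ (a : ℂ) (Q : Matrix (Fin n) (Fin n) ℂ), IsStarProjection Q ∧ IsRemovalStep A B a Q ∧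
      ((¬ ∃ w, IsPole A w ∨ IsPole B w) → a = b) := by
  by_cases h : ∃ w, IsPole A w ∨ IsPole B w
  · obtain ⟨a, ha⟩ := exists_nearest_isPole hA hB h
    obtain ⟨Q, hQ, hr⟩ := exists_isStarProjection_range_eq (poleSpan A B a)
    exact ⟨a, Q, hQ, ⟨fun _ => ha, hr⟩, fun h' => absurd h h'⟩
  · obtain ⟨Q, hQ, hr⟩ := exists_isStarProjection_range_eq (poleSpan A B b)
    exact ⟨b, Q, hQ, ⟨fun h' => absurd h' h, hr⟩, fun _ => rfl⟩

theorem isEntire_partialProduct (a : ℕ → ℂ) {Q : ℕ → Matrix (Fin n) (Fin n) ℂ}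
    (hQ : ∀ k, IsStarProjection (Q k)) (k : ℕ) : IsEntire (partialProduct a Q k) := by
  convert isEntire_tailProduct a hQ 0 k using 1
  exact funext (partialProduct_eq_tailProduct a Q k)

theorem partialProduct_apply_zero (a : ℕ → ℂ) {Q : ℕ → Matrix (Fin n) (Fin n) ℂ}
    (hQ : ∀ k, IsStarProjection (Q k)) (k : ℕ) : partialProduct a Q k 0 = 1 := by
  induction k with
  | zero => rfl
  | succ k ih => rw [partialProduct, ih, factor_apply_zero (hQ k).isIdempotentElem, mul_one]

/-- When no pole is left the point is free; the default `k + 1` is nonzero and tends to infinity. -/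
theorem exists_removal_sequence (hA : IsMeromorphic A) (hB : IsMeromorphic B) :
    ∃ (a : ℕ → ℂ) (Q : ℕ → Matrix (Fin n) (Fin n) ℂ), (∀ k, IsStarProjection (Q k)) ∧
      ∀ k, IsRemovalStep (fun z => partialProduct a Q k z * A z)
          (fun z => partialProduct a Q k z * B z) (a k) (Q k) ∧
        ((¬ ∃ w, IsPole (fun z => partialProduct a Q k z * A z) w ∨
          IsPole (fun z => partialProduct a Q k z * B z) w) → a k = k + 1) := by
  -- Quantifying over all `T`, with entireness as a premise of the conclusion, lets `choose` give
  -- functions that can be iterated before entireness is known.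
  have hstep : ∀ (k : ℕ) (T : ℂ → Matrix (Fin n) (Fin n) ℂ),
      ∃ (a : ℂ) (Q : Matrix (Fin n) (Fin n) ℂ), IsEntire T → IsStarProjection Q ∧
        IsRemovalStep (fun z => T z * A z) (fun z => T z * B z) a Q ∧
        ((¬ ∃ w, IsPole (fun z => T z * A z) w ∨ IsPole (fun z => T z * B z) w) →
          a = k + 1) := by
    intro k T
    by_cases hT : IsEntire T
    · obtain ⟨a, Q, h⟩ := exists_isRemovalStep (hT.isMeromorphic.mul hA)
        (hT.isMeromorphic.mul hB) (k + 1)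
      exact ⟨a, Q, fun _ => h⟩
    · exact ⟨0, 0, fun h => absurd h hT⟩
  choose f q hfq using hstep
  let T : ℕ → ℂ → Matrix (Fin n) (Fin n) ℂ := fun k => Nat.rec (fun _ => 1)
    (fun k S z => factor (k + 1) (f k S) (q k S) z * S z) k
  have hT : ∀ k, IsEntire (T k) := by
    intro k
    induction k with
    | zero => exact fun i j => differentiable_const _
    | succ k ih => exact (isEntire_factor (hfq k (T k) ih).1.isIdempotentElem _ _).mul ih
  have hP : ∀ k, partialProduct (fun k => f k (T k)) (fun k => q k (T k)) k = T k := by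
    intro k
    induction k with
    | zero => rfl
    | succ k ih =>
      funext z
      rw [partialProduct, ih]
  refine ⟨fun k => f k (T k), fun k => q k (T k), fun k => (hfq k (T k) (hT k)).1, fun k => ?_⟩
  rw [hP]
  exact (hfq k (T k) (hT k)).2

end step

/-! ### Every pole is eventually removed. -/

section removal

variable {A B : ℂ → Matrix (Fin n) (Fin n) ℂ} {a : ℕ → ℂ} {Q : ℕ → Matrix (Fin n) (Fin n) ℂ}

theorem not_isPole_partialProduct_mul_zero (hQ : ∀ k, IsStarProjection (Q k))
    (hA0 : IsHolomorphicAt A 0) (k : ℕ) :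
    ¬ IsPole (fun z => partialProduct a Q k z * A z) 0 :=
  (((isEntire_partialProduct a hQ k).isHolomorphicAt 0).mul hA0).not_isPole

theorem removal_ne_zero (hQ : ∀ k, IsStarProjection (Q k))
    (hA0 : IsHolomorphicAt A 0) (hB0 : IsHolomorphicAt B 0)
    (hstep : ∀ k, IsRemovalStep (fun z => partialProduct a Q k z * A z)
      (fun z => partialProduct a Q k z * B z) (a k) (Q k))
    (hnone : ∀ k, (¬ ∃ w, IsPole (fun z => partialProduct a Q k z * A z) w ∨
      IsPole (fun z => partialProduct a Q k z * B z) w) → a k = k + 1) (k : ℕ) : a k ≠ 0 := by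
  intro h0
  by_cases h : ∃ w, IsPole (fun z => partialProduct a Q k z * A z) w ∨
      IsPole (fun z => partialProduct a Q k z * B z) w
  · have := ((hstep k).nearest h).1
    rw [h0] at this
    exact this.elim (not_isPole_partialProduct_mul_zero hQ hA0 k)
      (not_isPole_partialProduct_mul_zero hQ hB0 k)
  · exact Nat.cast_add_one_ne_zero (R := ℂ) k ((hnone k h).symm.trans h0)

theorem poleOrder_partialProduct_succ_mul_le (hQ : ∀ k, IsStarProjection (Q k))
    (hA : IsMeromorphic A) (k : ℕ) (w : ℂ) :
    poleOrder (fun z => partialProduct a Q (k + 1) z * A z) w ≤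
      poleOrder (fun z => partialProduct a Q k z * A z) w := by
  have := ((isEntire_partialProduct a hQ k).isMeromorphic.mul hA).poleOrder_mul_le
    ((isEntire_factor (hQ k).isIdempotentElem (k + 1) (a k)).isHolomorphicAt w)
  simpa only [partialProduct, mul_assoc] using this

theorem poleOrder_partialProduct_succ_mul_lt (hQ : ∀ k, IsStarProjection (Q k))
    (hA : IsMeromorphic A) (hA0 : IsHolomorphicAt A 0) (hdet : (A 0).det ≠ 0) {k : ℕ}
    (ha : a k ≠ 0) (hpole : IsPole (fun z => partialProduct a Q k z * A z) (a k))
    (hV : ∀ u, IsPoleVector (fun z => partialProduct a Q k z * A z) (a k) u →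
      u ∈ LinearMap.range (Q k).mulVecLin) :
    poleOrder (fun z => partialProduct a Q (k + 1) z * A z) (a k) <
      poleOrder (fun z => partialProduct a Q k z * A z) (a k) := by
  have hT := isEntire_partialProduct a hQ k
  have hm := hT.isMeromorphic.mul hA
  have := hm.poleOrder_factor_mul_lt (hm.eventually_det_ne_zero ((hT.isHolomorphicAt 0).mul hA0)
    (by simpa [partialProduct_apply_zero a hQ] using hdet) (a k)) ha hpole
    (hQ k).isIdempotentElem hV (k + 1)
  simpa only [partialProduct, mul_assoc] using this

theorem isPole_of_isPole_partialProduct_mul (hQ : ∀ k, IsStarProjection (Q k))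
    (hA : IsMeromorphic A) {k : ℕ} {w : ℂ}
    (h : IsPole (fun z => partialProduct a Q k z * A z) w) : IsPole A w := by
  have hT := isEntire_partialProduct a hQ k
  have h1 := (hT.isMeromorphic.mul hA).isPole_iff.1 h
  have h2 := hA.poleOrder_mul_le (hT.isHolomorphicAt w)
  exact hA.isPole_iff.2 (by omega)

theorem tendsto_norm_removal (hA : IsMeromorphic A) (hB : IsMeromorphic B)
    (hA0 : IsHolomorphicAt A 0) (hdetA : (A 0).det ≠ 0)
    (hB0 : IsHolomorphicAt B 0) (hdetB : (B 0).det ≠ 0) (hQ : ∀ k, IsStarProjection (Q k))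
    (hstep : ∀ k, IsRemovalStep (fun z => partialProduct a Q k z * A z)
      (fun z => partialProduct a Q k z * B z) (a k) (Q k))
    (hnone : ∀ k, (¬ ∃ w, IsPole (fun z => partialProduct a Q k z * A z) w ∨
      IsPole (fun z => partialProduct a Q k z * B z) w) → a k = k + 1) :
    Tendsto (fun k => ‖a k‖) atTop atTop := by
  have hne := removal_ne_zero hQ hA0 hB0 hstep hnone
  refine tendsto_atTop.2 fun R => ?_
  have hK := isCompact_closedBall (0 : ℂ) R
  have hfin := (hA.finite_isPole_inter hK).union (hB.finite_isPole_inter hK)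
  rw [← Set.inter_union_distrib_left] at hfin
  -- Total pole order left, over the original poles in the disc of radius `R`. It never increases,
  -- and drops whenever a pole with `‖a k‖ < R` is treated.
  let N : ℕ → ℕ := fun k => ∑ w ∈ hfin.toFinset,
    (poleOrder (fun z => partialProduct a Q k z * A z) w +
      poleOrder (fun z => partialProduct a Q k z * B z) w)
  have hle : ∀ k w, poleOrder (fun z => partialProduct a Q (k + 1) z * A z) w +
      poleOrder (fun z => partialProduct a Q (k + 1) z * B z) w ≤
      poleOrder (fun z => partialProduct a Q k z * A z) w +
      poleOrder (fun z => partialProduct a Q k z * B z) w := fun k w =>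
    add_le_add (poleOrder_partialProduct_succ_mul_le hQ hA k w)
      (poleOrder_partialProduct_succ_mul_le hQ hB k w)
  have hanti : Antitone N := antitone_nat_of_succ_le fun k => Finset.sum_le_sum fun w _ => hle k w
  -- `N` is minimal at `K`, so no drop occurs later; `M` handles the default points.
  obtain ⟨K, hKmin⟩ := Nat.sInf_mem (Set.range_nonempty N)
  obtain ⟨M, hM⟩ := exists_nat_ge R
  filter_upwards [eventually_ge_atTop (max K M)] with k hk
  by_contra! hlt
  by_cases h : ∃ w, IsPole (fun z => partialProduct a Q k z * A z) w ∨
      IsPole (fun z => partialProduct a Q k z * B z) w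
  · have hp := ((hstep k).nearest h).1
    have hmem : a k ∈ hfin.toFinset := by
      rw [Set.Finite.mem_toFinset]
      exact ⟨by simpa using hlt.le, hp.imp (isPole_of_isPole_partialProduct_mul hQ hA)
        (isPole_of_isPole_partialProduct_mul hQ hB)⟩
    have hsucc : N (k + 1) < N k := by
      refine Finset.sum_lt_sum (fun w _ => hle k w) ⟨a k, hmem, ?_⟩
      rcases hp with hp | hp
      · refine add_lt_add_of_lt_of_le (poleOrder_partialProduct_succ_mul_lt hQ hA hA0 hdetA
          (hne k) hp fun u hu => ?_) (poleOrder_partialProduct_succ_mul_le hQ hB k _)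
        rw [(hstep k).range_eq]
        exact Submodule.subset_span (Or.inl hu)
      · refine add_lt_add_of_le_of_lt (poleOrder_partialProduct_succ_mul_le hQ hA k _)
          (poleOrder_partialProduct_succ_mul_lt hQ hB hB0 hdetB (hne k) hp fun u hu => ?_)
        rw [(hstep k).range_eq]
        exact Submodule.subset_span (Or.inr hu)
    have h1 : N k ≤ N K := hanti (by omega)
    have h2 : N K ≤ N (k + 1) := hKmin ▸ Nat.sInf_le ⟨k + 1, rfl⟩
    omega
  · have hak : ‖a k‖ = (k : ℝ) + 1 := by
      rw [hnone k h, ← Nat.cast_succ, Complex.norm_natCast, Nat.cast_succ]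
    have : (M : ℝ) ≤ k := by exact_mod_cast (le_max_right K M).trans hk
    linarith

theorem IsInfiniteProduct.not_isPole_mul {P : ℂ → Matrix (Fin n) (Fin n) ℂ}
    (hP : IsInfiniteProduct a Q P) (hA : IsMeromorphic A)
    (hnear : ∀ k w, IsPole (fun z => partialProduct a Q k z * A z) w → ‖a k‖ ≤ ‖w‖) (w : ℂ) :
    ¬ IsPole (fun z => P z * A z) w := by
  -- At such a `k` the nearest remaining pole lies beyond `w`, and the rest `R` of the product is
  -- entire.
  obtain ⟨k, hk⟩ := (hP.tendsto_norm.eventually_gt_atTop ‖w‖).exists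
  obtain ⟨R, hR, hPR⟩ := hP.exists_eq_mul_partialProduct k
  have hm := (isEntire_partialProduct a hP.projection k).isMeromorphic.mul hA
  have h0 : poleOrder (fun z => partialProduct a Q k z * A z) w = 0 := by
    by_contra h
    exact not_le.2 hk (hnear k w (hm.isPole_iff.2 h))
  have h1 := hm.poleOrder_mul_le (hR.isHolomorphicAt w)
  have h2 := (hR.isMeromorphic.mul hm).isPole_iff (w := w)
  simp only [hPR, mul_assoc]
  rw [h2]
  omega

end removal

end MatrixFactorization

end

/-! ### The factorization theorem. -/

theorem mainTheorem3 (n : ℕ) (A B : ℂ → Matrix (Fin n) (Fin n) ℂ)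
    (hA : MatrixFactorization.IsMeromorphic A) (hB : MatrixFactorization.IsMeromorphic B)
    (hA0 : MatrixFactorization.IsHolomorphicAt A 0) (hdetA : (A 0).det ≠ 0)
    (hB0 : MatrixFactorization.IsHolomorphicAt B 0) (hdetB : (B 0).det ≠ 0) :
    ∃ (a : ℕ → ℂ) (Q : ℕ → Matrix (Fin n) (Fin n) ℂ)
      (P A' B' : ℂ → Matrix (Fin n) (Fin n) ℂ),
      MatrixFactorization.IsInfiniteProduct a Q P ∧
      MatrixFactorization.IsEntire P ∧
      MatrixFactorization.IsEntire A' ∧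
      (∀ z, MatrixFactorization.IsHolomorphicAt A z → A' z = P z * A z) ∧
      MatrixFactorization.IsEntire B' ∧
      (∀ z, MatrixFactorization.IsHolomorphicAt B z → B' z = P z * B z) ∧
      ∀ k, MatrixFactorization.IsRemovalStep
        (fun z => MatrixFactorization.partialProduct a Q k z * A z)
        (fun z => MatrixFactorization.partialProduct a Q k z * B z) (a k) (Q k) := by
  open MatrixFactorization in
  obtain ⟨a, Q, hQ, h⟩ := exists_removal_sequence hA hB
  have hstep := fun k => (h k).1
  have hnone := fun k => (h k).2
  have hlim := tendsto_norm_removal hA hB hA0 hdetA hB0 hdetB hQ hstep hnone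
  obtain ⟨P, hP, hPu⟩ := exists_isEntire_tendstoUniformlyOn_tailProduct hQ hlim 0
  have hprod : IsInfiniteProduct a Q P :=
    ⟨hQ, removal_ne_zero hQ hA0 hB0 hstep hnone, hlim, by
      simpa only [partialProduct_eq_tailProduct] using hPu⟩
  obtain ⟨A', hA', hAval⟩ := exists_isEntire_of_not_isPole (hP.isMeromorphic.mul hA)
    (hprod.not_isPole_mul hA fun k w hw =>
      ((hstep k).nearest ⟨w, Or.inl hw⟩).2 w (Or.inl hw))
  obtain ⟨B', hB', hBval⟩ := exists_isEntire_of_not_isPole (hP.isMeromorphic.mul hB)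
    (hprod.not_isPole_mul hB fun k w hw =>
      ((hstep k).nearest ⟨w, Or.inr hw⟩).2 w (Or.inr hw))
  exact ⟨a, Q, P, A', B', hprod, hP, hA',
    fun z hz => hAval z ((hP.isHolomorphicAt z).mul hz), hB',
    fun z hz => hBval z ((hP.isHolomorphicAt z).mul hz), hstep⟩
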